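/- Consider $N$ scalar sub-systems that share one wireless channel with slots $1,2,\dots$ of length $\Delta>0$. Sub-system $i$ has the plant $\dot x=A_ix+B_iu$ with $A_i\ge 0$, $B_i\ne 0$, and is sampled every $h_i\ge 1$ slots; its $k$-th period consists of the slots $(k-1)h_i+1,\dots,kh_i$. At the start of period $k$ it generates a control packet $u^i_k$, which is lost if it is not delivered by the end of that period. In each slot a scheduler chooses one sub-system $a\in[N]$; if its current packet is still undelivered, the packet is delivered in this slot with probability $p_a\in(0,1]$. A scheduling policy chooses the sub-system, possibly at random, from the past choices and delivery acknowledgements. Let $\gamma^i_k\in\{0,1\}$ indicate whether $u^i_k$ is delivered. With $\bar A_i=e^{A_ih_i\Delta}$ and $\bar B_i=\int_0^{h_i\Delta}e^{A_i\tau}B_i\,d\tau$, the sampled state satisfies $x^i_{k+1}=\bar A_ix^i_k+\gamma^i_{k-1}\bar B_iu^i_{k-1}$ for $k\ge 1$. Control policies are linear in the predicted state: $u^i_k=-K_i\bigl(\bar A_ix^i_k+(1-q_i)\bar B_iu^i_{k-1}\bigr)$ with $K_i\in\mathbb R$, $q_i\in[0,1]$. Sub-system $i$ is mean-square stable if $\lim_{k\to\infty}\mathbb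 E|x^i_k|^2=0$ for all initial conditions $x^i_1,u^i_0\in\mathbb R$, $\gamma^i_0\in\{0,1\}$. The system can be stabilized if some scheduling policy and some control policies make all $N$ sub-systems mean-square stable. Let $H=\operatorname{lcm}(h_1,\dots,h_N)$, $n_i=H/h_i$, and $$q^i_{\max}(A_i,h_i)=\frac1{e^{4A_ih_i\Delta}-e^{2A_ih_i\Delta}+1}.$$ Let $\mathcal S=\{0,1\}^N$, where $s_i=1$ means that sub-system $i$ has an undelivered packet, let $\mathcal A=[N]$, and let $r_i(s,a)=p_i$ if $s_i=1$ and $a=i$, and $r_i(s,a)=0$ otherwise. Let $P_t(s'\mid s,a)$ be the probability that the state in slot $t+1$ is $s'$ if in slot $t$ the state is $s$ and sub-system $a$ is chosen (a delivered packet leaves the system, and $s'_i=1$ whenever $h_i\mid t$). Theorem. The system can be stabilized if there are real numbers $x_t(s,a)$, $t\in[H]$, $s\in\mathcal S$, $a\in\mathcal A$, such that $$\sum_{a}x_{t+1}(s',a)=\sum_{s}\sum_{a}x_t(s,a)P_t(s'\mid s,a)\qquad\forall s'\in\mathcal S,\ t\in[H-1],$$ $$\sum_{a}x_1(s',a)=\sum_{s}\sum_{a}x_H(s,a)P_H(s'\mid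 s,a)\qquad\forall s'\in\mathcal S,$$ $$1-q^i_{\max}(A_i,h_i)<\sum_{t=(j-1)h_i+1}^{jh_i}\sum_{s}\sum_{a}x_t(s,a)r_i(s,a)\qquad\forall i\in[N],\ j\in[n_i],$$ $$\sum_{s}\sum_{a}x_t(s,a)=1\quad\forall t\in[H],\qquad x_t(s,a)\ge 0\quad\forall t\in[H],\ s\in\mathcal S,\ a\in\mathcal A.$$ -/

import Mathlib

open Filter Topology

noncomputable section

/-- Parameters of a wireless networked control system with `N` scalar sub-systems that share one
wireless channel.  Sub-system `i` has the plant `ẋ = A i * x + B i * u`, its control packets are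
delivered with probability `p i` in a slot in which they are transmitted, and it is sampled every
`h i` slots; a slot lasts `Δ` units of time. -/
structure WNCS (N : ℕ) where
  A : Fin N → ℝ
  B : Fin N → ℝ
  p : Fin N → ℝ
  h : Fin N → ℕ
  Δ : ℝ
  A_nonneg : ∀ i, 0 ≤ A i
  B_ne_zero : ∀ i, B i ≠ 0
  p_pos : ∀ i, 0 < p i
  p_le_one : ∀ i, p i ≤ 1
  h_pos : ∀ i, 0 < h i
  Δ_pos : 0 < Δ

namespace WNCS

variable {N : ℕ} (W : WNCS N)

/-- `Ā i = exp (A i * h i * Δ)`. -/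
def Abar (i : Fin N) : ℝ := Real.exp (W.A i * W.h i * W.Δ)

/-- `B̄ i = ∫_0^{h i * Δ} exp (A i * τ) * B i dτ`. -/
def Bbar (i : Fin N) : ℝ := ∫ τ in (0 : ℝ)..(W.h i * W.Δ), Real.exp (W.A i * τ) * W.B i

/-- The maximum dropout rate of sub-system `i`. -/
def qMax (i : Fin N) : ℝ :=
  1 / (Real.exp (4 * W.A i * W.h i * W.Δ) - Real.exp (2 * W.A i * W.h i * W.Δ) + 1)

/-- The length of a big frame: the least common multiple of the sampling periods. -/
def H : ℕ := Finset.univ.lcm W.h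

/-- The number of periods of sub-system `i` in a big frame. -/
def n (i : Fin N) : ℕ := W.H / W.h i

/-! ### The Markov decision process of the network

A network state tells which sub-systems have an undelivered packet; the action `a` transmits the
packet of sub-system `a` (and does nothing if that sub-system has no packet).  Slots are numbered
`1, 2, …`; the `k`-th period of sub-system `i` consists of the slots `(k-1) * h i + 1, …, k * h i`.
-/

/-- Probability that the transmission of `a`'s packet results in a delivery, in state `s`. -/
def successProb (s : Fin N → Bool) (a : Fin N) : ℝ := if s a = true then W.p a else 0

/-- Expected number of packets of sub-system `i` delivered in a slot with state `s`, action `a`. -/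
def reward (i : Fin N) (s : Fin N → Bool) (a : Fin N) : ℝ :=
  W.p i * (if s i = true ∧ a = i then 1 else 0)

/-- The state in slot `t + 1`, if in slot `t` the state is `s`, the action is `a`, and `d` tells
whether a packet was delivered: a new packet replaces the old one when a period has ended with
slot `t`, and a delivered packet leaves the system. -/
def nextState (t : ℕ) (s : Fin N → Bool) (a : Fin N) (d : Bool) : Fin N → Bool :=
  fun i => if W.h i ∣ t then true else if d = true ∧ a = i then false else s i

/-- The transition probability `P_t(s' | s, a)`. -/
def transProb (t : ℕ) (s : Fin N → Bool) (a : Fin N) (s' : Fin N → Bool) : ℝ :=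
  W.successProb s a * (if s' = W.nextState t s a true then 1 else 0) +
    (1 - W.successProb s a) * (if s' = W.nextState t s a false then 1 else 0)

/-! ### Scheduling policies and the law of the network -/

/-- What is known after `t` slots: for every slot the action and whether it led to a delivery.
The entry with index `s : Fin t` belongs to slot `s + 1`. -/
abbrev History (N t : ℕ) : Type := Fin t → Fin N × Bool

/-- A (causal, possibly randomized and history-dependent) scheduling policy: the distribution of
the action in slot `t + 1` given the actions and the acknowledgements in slots `1, …, t`. -/
abbrev SchedulingPolicy (N : ℕ) : Type := ∀ t : ℕ, History N t → PMF (Fin N)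

/-- The network state in slot `t + 1` after the history `ω`: sub-system `i` has a packet unless its
packet was delivered in an earlier slot of the same period. -/
def packetState {t : ℕ} (ω : History N t) : Fin N → Bool :=
  fun i => decide (∀ s : Fin t, (s : ℕ) / W.h i = t / W.h i → ω s ≠ (i, true))

lemma successProb_nonneg (s : Fin N → Bool) (a : Fin N) : 0 ≤ W.successProb s a := by
  unfold successProb
  split_ifs
  · exact (W.p_pos a).le
  · exact le_rfl

lemma successProb_le_one (s : Fin N → Bool) (a : Fin N) : W.successProb s a ≤ 1 := by
  unfold successProb
  split_ifs
  · exact W.p_le_one a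
  · exact zero_le_one

/-- The law of the delivery indicator in a slot with state `s` and action `a`: it is `true` with
probability `successProb s a`. -/
def deliveryLaw (s : Fin N → Bool) (a : Fin N) : PMF Bool :=
  PMF.ofFintype
    (fun d => ENNReal.ofReal (if d = true then W.successProb s a else 1 - W.successProb s a)) (by
      have h1 := W.successProb_le_one s a
      rw [Fintype.sum_bool, if_pos rfl, if_neg (by decide),
        ← ENNReal.ofReal_add (W.successProb_nonneg s a) (by linarith), add_sub_cancel,
        ENNReal.ofReal_one])

/-- The law of the history of the first `t` slots under the scheduling policy `π`. -/
def historyLaw (π : SchedulingPolicy N) : (t : ℕ) → PMF (History N t)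
  | 0 => PMF.pure Fin.elim0
  | t + 1 =>
    (historyLaw π t).bind fun ω =>
      (π t ω).bind fun a =>
        (W.deliveryLaw (W.packetState ω) a).bind fun d =>
          PMF.pure (Fin.snoc (α := fun _ => Fin N × Bool) ω (a, d))

/-- `γ^i_k` for `k ≥ 1`: whether the `k`-th control packet of sub-system `i` is delivered before or
at the end of its period; `γ^i_0 = γ₀` is an initial condition. -/
def delivered (i : Fin N) (γ₀ : Bool) {t : ℕ} (ω : History N t) (k : ℕ) : Bool :=
  if k = 0 then γ₀
  else decide (∃ s : Fin t, (k - 1) * W.h i ≤ (s : ℕ) ∧ (s : ℕ) < k * W.h i ∧ ω s = (i, true))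

/-! ### Control policies and mean-square stability -/

/-- A linear control policy with respect to the predicted state: a gain `K` and the dropout rate `q`
with which the state is predicted. -/
structure ControlPolicy where
  K : ℝ
  q : ℝ
  q_nonneg : 0 ≤ q
  q_le_one : q ≤ 1

/-- The state in period `k + 1` as predicted from the state `x` in period `k` and the control `u`
of period `k - 1`. -/
def predictedState (i : Fin N) (c : ControlPolicy) (x u : ℝ) : ℝ :=
  W.Abar i * x + (1 - c.q) * W.Bbar i * u

/-- The closed loop of sub-system `i` for the delivery indicators `γ 0, γ 1, …` and the initial
conditions `x₁, u₀`.  The value at `k` is the pair `(x_{k+1}, u_k)`, where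
`x_{k+1} = Ā x_k + γ_{k-1} B̄ u_{k-1}` and `u_k` is `- K` times the predicted state. -/
def closedLoop (i : Fin N) (c : ControlPolicy) (x₁ u₀ : ℝ) (γ : ℕ → Bool) : ℕ → ℝ × ℝ
  | 0 => (x₁, u₀)
  | k + 1 =>
    let x := (closedLoop i c x₁ u₀ γ k).1
    let u := (closedLoop i c x₁ u₀ γ k).2
    (W.Abar i * x + (if γ k = true then 1 else 0) * W.Bbar i * u,
      -c.K * W.predictedState i c x u)

/-- `E[|x^i_{k+1}|^2]`; the sample `x^i_{k+1}` is taken right after slot `k * h i`. -/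
def secondMoment (π : SchedulingPolicy N) (c : ControlPolicy) (i : Fin N) (x₁ u₀ : ℝ) (γ₀ : Bool)
    (k : ℕ) : ℝ :=
  ∑ ω : History N (k * W.h i), (W.historyLaw π (k * W.h i) ω).toReal *
    |(W.closedLoop i c x₁ u₀ (W.delivered i γ₀ ω) k).1| ^ 2

/-- Sub-system `i` is mean-square stable: for all initial conditions `x^i_1`, `u^i_0`, `γ^i_0`, the
second moment of the state tends to zero. -/
def MeanSquareStable (π : SchedulingPolicy N) (c : ControlPolicy) (i : Fin N) : Prop :=
  ∀ (x₁ u₀ : ℝ) (γ₀ : Bool), Tendsto (W.secondMoment π c i x₁ u₀ γ₀) atTop (𝓝 0)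

/-- The system can be stabilized: some scheduling policy together with some control policies makes
all sub-systems mean-square stable. -/
def CanBeStabilized : Prop :=
  ∃ (π : SchedulingPolicy N) (c : Fin N → ControlPolicy), ∀ i, W.MeanSquareStable π (c i) i

end WNCS

end

noncomputable section

namespace WNCS

variable {N : ℕ} (W : WNCS N)

/-! Feasibility enters through one inequality per sub-system. Inside a period, the mass of states
with a pending packet loses at most the fraction `p i` per slot, so the deliveries of a period sum
to at most `1 - (1 - p i) ^ h i`, and the rate constraint yields `(1 - p i) ^ h i < qMax i`
(`one_sub_p_pow_lt_qMax`). The stabilizing policy is not read off from `x`.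

With a single sub-system, permanent service makes the dropouts of different periods independent with
rate `(1 - p i) ^ h i`. Below `qMax i`, a quadratic form in the predicted state and the control in
flight contracts in mean (`exists_lyapunov`).

With at least two sub-systems, they can be dealt with one at a time, because the plants are
noise-free: a deadbeat control delivered in a period whose two neighbours have no delivery puts the
state at exactly zero forever (`deadbeat_eq_zero`). The targets are served by decreasing `A`, each
until one such delivery; another sub-system fills the idle frames around it. The probability that
`tgt j` is still waiting after `T` slots is `O(ρ ^ T)` for `ρ` above every `1 - p (tgt j')`, `j' ≤
j` (`expect_stagePotential_le`), while its squared state is `O(exp (2 * A * Δ * T))` until then.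
Since `qMax i ≤ exp (-(2 * A i * Δ)) ^ h i`, each `1 - p i` is below `exp (-(2 * A i * Δ))`; the
ordering carries this over to all earlier targets and leaves room for a `ρ` that makes the product
decay. -/

/-! ### Expectations under the law of the history -/

lemma _root_.PMF.sum_toReal_bind_mul {α β : Type*} [Fintype α] [Fintype β] (p : PMF α)
    (f : α → PMF β) (F : β → ℝ) :
    ∑ b, (p.bind f b).toReal * F b = ∑ a, (p a).toReal * ∑ b, (f a b).toReal * F b := by
  have h : ∀ b, (p.bind f b).toReal = ∑ a, (p a).toReal * (f a b).toReal := by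
    intro b
    rw [PMF.bind_apply, tsum_fintype, ENNReal.toReal_sum]
    · simp [ENNReal.toReal_mul]
    · intro a _
      exact ENNReal.mul_ne_top (p.apply_ne_top a) ((f a).apply_ne_top b)
  simp only [h, Finset.sum_mul, Finset.mul_sum]
  rw [Finset.sum_comm]
  simp [mul_assoc]

lemma _root_.PMF.sum_toReal_pure_mul {α : Type*} [Fintype α] (a : α) (F : α → ℝ) :
    ∑ b, (PMF.pure a b).toReal * F b = F a := by
  classical
  rw [Finset.sum_eq_single a]
  · simp
  · intro b _ hb
    simp [PMF.pure_apply, hb]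
  · simp

/-- The expectation of a function of the history of the first `t` slots. -/
def expect (π : SchedulingPolicy N) (t : ℕ) (F : History N t → ℝ) : ℝ :=
  ∑ ω, (W.historyLaw π t ω).toReal * F ω

/-- The policy that takes the action `act t ω` after the history `ω`. -/
def detPolicy (act : ∀ t, History N t → Fin N) : SchedulingPolicy N := fun t ω => PMF.pure (act t ω)

/-- The history `ω`, followed by one more slot. -/
abbrev extend {t : ℕ} (ω : History N t) (c : Fin N × Bool) : History N (t + 1) :=
  Fin.snoc (α := fun _ => Fin N × Bool) ω c

lemma expect_zero (π : SchedulingPolicy N) (F : History N 0 → ℝ) :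
    W.expect π 0 F = F Fin.elim0 :=
  PMF.sum_toReal_pure_mul _ F

lemma expect_succ (act : ∀ t, History N t → Fin N) (t : ℕ) (F : History N (t + 1) → ℝ) :
    W.expect (detPolicy act) (t + 1) F = W.expect (detPolicy act) t fun ω =>
      W.successProb (packetState W ω) (act t ω) * F (extend ω (act t ω, true)) +
        (1 - W.successProb (packetState W ω) (act t ω)) * F (extend ω (act t ω, false)) := by
  unfold expect
  simp only [historyLaw, PMF.sum_toReal_bind_mul]
  refine Finset.sum_congr rfl fun ω _ => ?_
  congr 1
  simp only [detPolicy]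
  rw [PMF.sum_toReal_pure_mul (act t ω) fun a => ∑ d, (W.deliveryLaw (W.packetState ω) a d).toReal *
    ∑ ω', (PMF.pure (extend ω (a, d)) ω').toReal * F ω']
  simp only [PMF.sum_toReal_pure_mul, Fintype.sum_bool, deliveryLaw, PMF.ofFintype_apply]
  rw [if_pos trivial, if_neg (by decide), ENNReal.toReal_ofReal (W.successProb_nonneg _ _),
    ENNReal.toReal_ofReal (by linarith [W.successProb_le_one (W.packetState ω) (act t ω)])]

lemma expect_congr (π : SchedulingPolicy N) (t : ℕ) {F G : History N t → ℝ} (h : ∀ ω, F ω = G ω) :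
    W.expect π t F = W.expect π t G := by
  rw [funext h]

lemma expect_mono (π : SchedulingPolicy N) (t : ℕ) {F G : History N t → ℝ} (h : ∀ ω, F ω ≤ G ω) :
    W.expect π t F ≤ W.expect π t G :=
  Finset.sum_le_sum fun ω _ => mul_le_mul_of_nonneg_left (h ω) ENNReal.toReal_nonneg

lemma expect_nonneg (π : SchedulingPolicy N) (t : ℕ) {F : History N t → ℝ} (h : ∀ ω, 0 ≤ F ω) :
    0 ≤ W.expect π t F :=
  Finset.sum_nonneg fun ω _ => mul_nonneg ENNReal.toReal_nonneg (h ω)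

lemma expect_const_mul (π : SchedulingPolicy N) (t : ℕ) (c : ℝ) (F : History N t → ℝ) :
    W.expect π t (fun ω => c * F ω) = c * W.expect π t F := by
  unfold expect
  rw [Finset.mul_sum]
  exact Finset.sum_congr rfl fun ω _ => by ring

/-- Lets pathwise statements about the scheduler be proved by induction along the histories of
positive probability. -/
lemma mem_support_historyLaw (act : ∀ t, History N t → Fin N) {t : ℕ} {ω : History N (t + 1)}
    (h : W.historyLaw (detPolicy act) (t + 1) ω ≠ 0) :
    ∃ (ω' : History N t) (d : Bool), W.historyLaw (detPolicy act) t ω' ≠ 0 ∧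
      ω = extend ω' (act t ω', d) := by
  have h' : ω ∈ (W.historyLaw (detPolicy act) (t + 1)).support := h
  simp only [historyLaw, PMF.mem_support_bind_iff, detPolicy, PMF.mem_support_pure_iff] at h'
  obtain ⟨ω', hω', a, rfl, d, -, rfl⟩ := h'
  exact ⟨ω', d, hω', rfl⟩

lemma expect_mono_of_support (π : SchedulingPolicy N) (t : ℕ) {F G : History N t → ℝ}
    (h : ∀ ω, W.historyLaw π t ω ≠ 0 → F ω ≤ G ω) : W.expect π t F ≤ W.expect π t G := by
  refine Finset.sum_le_sum fun ω _ => ?_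
  by_cases h0 : W.historyLaw π t ω = 0
  · simp [h0]
  · exact mul_le_mul_of_nonneg_left (h ω h0) ENNReal.toReal_nonneg

/-! ### What feasibility of the linear program implies -/

lemma H_pos : 0 < W.H := by
  refine Nat.pos_of_ne_zero fun h => ?_
  obtain ⟨i, -, hi⟩ := Finset.lcm_eq_zero_iff.1 h
  exact (W.h_pos i).ne' hi

lemma h_dvd_H (i : Fin N) : W.h i ∣ W.H := Finset.dvd_lcm (Finset.mem_univ i)

lemma h_le_H (i : Fin N) : W.h i ≤ W.H := Nat.le_of_dvd W.H_pos (W.h_dvd_H i)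

/-- The mass of the state-action pairs in which sub-system `i` has an undelivered packet. -/
def pendingMass (i : Fin N) (y : (Fin N → Bool) → Fin N → ℝ) : ℝ :=
  ∑ s, ∑ a, y s a * (if s i = true then 1 else 0)

/-- Away from the end of a period no new packet arrives, so the pending indicator drops exactly by
the expected delivery. -/
lemma sum_transProb_pending (i : Fin N) {t : ℕ} (ht : ¬ W.h i ∣ t) (s : Fin N → Bool) (a : Fin N) :
    ∑ s' : Fin N → Bool, (if s' i = true then 1 else 0) * W.transProb t s a s' =
      (if s i = true then 1 else 0) - W.reward i s a := by
  have h : ∀ s' : Fin N → Bool, (if s' i = true then (1 : ℝ) else 0) * W.transProb t s a s' =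
      (if s' = W.nextState t s a true then
        W.successProb s a * (if W.nextState t s a true i = true then 1 else 0) else 0) +
      (if s' = W.nextState t s a false then
        (1 - W.successProb s a) * (if W.nextState t s a false i = true then 1 else 0) else 0) := by
    intro s'
    have key : ∀ (z : Fin N → Bool) (c : ℝ),
        (if s' i = true then (1 : ℝ) else 0) * (c * if s' = z then 1 else 0) =
          if s' = z then c * (if z i = true then 1 else 0) else 0 := by
      intro z c
      by_cases hz : s' = z
      · subst hz
        simp
      · simp [hz]
    rw [transProb, mul_add, key, key]
  simp only [h, Finset.sum_add_distrib, Finset.sum_ite_eq', Finset.mem_univ, if_true]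
  simp only [nextState, ht, if_false, reward, successProb]
  by_cases hi : a = i
  · subst hi
    by_cases hs : s a = true <;> simp [hs]
  · by_cases hs : s i = true <;> by_cases hs' : s a = true <;> simp [hs, hs', hi]

variable {W} in
/-- Feasibility of the linear program bounds the dropout rate under permanent service. -/
lemma one_sub_p_pow_lt_qMax {x : ℕ → (Fin N → Bool) → Fin N → ℝ}
    (hflow : ∀ s' : Fin N → Bool, ∀ t ∈ Finset.Icc 1 (W.H - 1),
      ∑ a, x (t + 1) s' a = ∑ s, ∑ a, x t s a * W.transProb t s a s')
    (hrate : ∀ i : Fin N, ∀ j ∈ Finset.Icc 1 (W.n i),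
      1 - W.qMax i <
        ∑ t ∈ Finset.Icc ((j - 1) * W.h i + 1) (j * W.h i), ∑ s, ∑ a, x t s a * W.reward i s a)
    (hprob : ∀ t ∈ Finset.Icc 1 W.H, ∑ s, ∑ a, x t s a = 1)
    (hnonneg : ∀ t ∈ Finset.Icc 1 W.H, ∀ s a, 0 ≤ x t s a) (i : Fin N) :
    (1 - W.p i) ^ W.h i < W.qMax i := by
  set R : ℕ → ℝ := fun t => ∑ s, ∑ a, x t s a * W.reward i s a with hR
  set U : ℕ → ℝ := fun t => pendingMass i (x t) with hU
  have hp := W.p_pos i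
  have hp1 := W.p_le_one i
  have hhH := W.h_le_H i
  have hRU : ∀ t ∈ Finset.Icc 1 W.H, R t ≤ W.p i * U t := by
    intro t ht
    simp only [hR, hU, pendingMass, Finset.mul_sum]
    refine Finset.sum_le_sum fun s _ => Finset.sum_le_sum fun a _ => ?_
    have := hnonneg t ht s a
    rw [mul_left_comm]
    refine mul_le_mul_of_nonneg_left ?_ this
    unfold reward
    refine mul_le_mul_of_nonneg_left ?_ hp.le
    split_ifs <;> simp_all
  have hU1 : U 1 ≤ 1 := by
    have h1 : (1 : ℕ) ∈ Finset.Icc 1 W.H := Finset.mem_Icc.2 ⟨le_rfl, W.H_pos⟩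
    rw [← hprob 1 h1]
    refine Finset.sum_le_sum fun s _ => Finset.sum_le_sum fun a _ => ?_
    have := hnonneg 1 h1 s a
    split_ifs <;> simp [this]
  have hstep : ∀ t, 1 ≤ t → t < W.h i → U (t + 1) = U t - R t := by
    intro t h1 h2
    have ht : ¬ W.h i ∣ t := fun h => absurd (Nat.le_of_dvd h1 h) (by omega)
    have hf := fun s' => hflow s' t (Finset.mem_Icc.2 ⟨h1, by omega⟩)
    calc U (t + 1) = ∑ s' : Fin N → Bool, (if s' i = true then 1 else 0) * ∑ a, x (t + 1) s' a := by
          simp only [hU, pendingMass, Finset.mul_sum]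
          exact Finset.sum_congr rfl fun s _ => Finset.sum_congr rfl fun a _ => mul_comm _ _
      _ = ∑ s, ∑ a, x t s a *
            ∑ s' : Fin N → Bool, (if s' i = true then 1 else 0) * W.transProb t s a s' := by
          simp only [hf, Finset.mul_sum]
          rw [Finset.sum_comm]
          refine Finset.sum_congr rfl fun s _ => ?_
          rw [Finset.sum_comm]
          exact Finset.sum_congr rfl fun a _ => Finset.sum_congr rfl fun s' _ => by ring
      _ = U t - R t := by
          simp only [W.sum_transProb_pending i ht, hU, hR, pendingMass, mul_sub,
            Finset.sum_sub_distrib]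
  -- Telescoping `hstep` gives the sum; combined with `R ≤ p * U`, it shows that at least the
  -- fraction `1 - p` of the pending mass survives each slot.
  have hind : ∀ m, m < W.h i → ∑ t ∈ Finset.Icc 1 m, R t = U 1 - U (m + 1) ∧
      (1 - W.p i) ^ m * U 1 ≤ U (m + 1) := by
    intro m
    induction m with
    | zero => intro _; simp
    | succ m ih =>
      intro hm
      obtain ⟨h1, h2⟩ := ih (by omega)
      have hs := hstep (m + 1) (by omega) hm
      have hru := hRU (m + 1) (Finset.mem_Icc.2 ⟨by omega, by omega⟩)
      refine ⟨by rw [Finset.sum_Icc_succ_top (by omega), h1, hs]; ring, ?_⟩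
      rw [hs, pow_succ]
      have := mul_le_mul_of_nonneg_left h2 (show 0 ≤ 1 - W.p i by linarith)
      nlinarith
  -- The last slot of the period is split off: after it a fresh packet arrives and `hstep` fails,
  -- but `R ≤ p * U` still holds in it.
  obtain ⟨m, hm⟩ : ∃ m, W.h i = m + 1 := ⟨W.h i - 1, by have := W.h_pos i; omega⟩
  obtain ⟨h1, h2⟩ := hind m (by omega)
  have hr := hrate i 1 (Finset.mem_Icc.2 ⟨le_rfl, Nat.div_pos hhH (W.h_pos i)⟩)
  have hru := hRU (m + 1) (Finset.mem_Icc.2 ⟨by omega, by omega⟩)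
  simp only [Nat.sub_self, zero_mul, zero_add, one_mul] at hr
  rw [hm, Finset.sum_Icc_succ_top (by omega)] at hr
  change 1 - W.qMax i < ∑ t ∈ Finset.Icc 1 m, R t + R (m + 1) at hr
  rw [hm, pow_succ]
  have h3 := mul_le_mul_of_nonneg_left h2 (show 0 ≤ 1 - W.p i by linarith)
  have h4 : (1 - W.p i) ^ m * (1 - W.p i) ≤ 1 := by
    rw [← pow_succ]
    exact pow_le_one₀ (by linarith) (by linarith)
  nlinarith

/-- With `y = exp (2 * A * h * Δ)`, this is `y ^ 2 - y + 1 ≥ y`, that is `(y - 1) ^ 2 ≥ 0`. -/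
lemma qMax_le (i : Fin N) : W.qMax i ≤ Real.exp (-(2 * W.A i * W.Δ)) ^ W.h i := by
  set y := Real.exp (2 * W.A i * W.h i * W.Δ) with hy
  have hy0 : 0 < y := Real.exp_pos _
  have h4 : Real.exp (4 * W.A i * W.h i * W.Δ) = y ^ 2 := by
    rw [hy, ← Real.exp_nat_mul]
    congr 1
    push_cast
    ring
  have h5 : Real.exp (-(2 * W.A i * W.Δ)) ^ W.h i = 1 / y := by
    rw [hy, ← Real.exp_nat_mul, one_div, ← Real.exp_neg]
    congr 1
    ring
  rw [qMax, h4, h5]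
  exact one_div_le_one_div_of_le hy0 (by nlinarith [sq_nonneg (y - 1)])

lemma one_sub_p_lt (i : Fin N) (h : (1 - W.p i) ^ W.h i < W.qMax i) :
    1 - W.p i < Real.exp (-(2 * W.A i * W.Δ)) :=
  lt_of_pow_lt_pow_left₀ _ (Real.exp_pos _).le (h.trans_le (W.qMax_le i))

lemma Abar_pos (i : Fin N) : 0 < W.Abar i := Real.exp_pos _

lemma Bbar_ne_zero (i : Fin N) : W.Bbar i ≠ 0 := by
  have hT : (0 : ℝ) < W.h i * W.Δ := mul_pos (Nat.cast_pos.2 (W.h_pos i)) W.Δ_pos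
  unfold Bbar
  rw [intervalIntegral.integral_mul_const]
  refine mul_ne_zero (ne_of_gt ?_) (W.B_ne_zero i)
  exact intervalIntegral.intervalIntegral_pos_of_pos
    (Continuous.intervalIntegrable (by fun_prop) _ _) (fun _ => Real.exp_pos _) hT

/-! ### Histories as infinite sequences -/

/-- A history, continued by an infinite sequence of slots without deliveries. -/
def toSeq (i₀ : Fin N) {t : ℕ} (ω : History N t) : ℕ → Fin N × Bool :=
  fun s => if hs : s < t then ω ⟨s, hs⟩ else (i₀, false)

lemma toSeq_extend_of_lt (i₀ : Fin N) {t : ℕ} (ω : History N t) (c : Fin N × Bool) {s : ℕ}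
    (hs : s < t) : toSeq i₀ (extend ω c) s = toSeq i₀ ω s := by
  have h1 : s < t + 1 := by omega
  simp only [toSeq, h1, hs, dif_pos]
  exact Fin.snoc_castSucc (α := fun _ => Fin N × Bool) c ω ⟨s, hs⟩

lemma toSeq_extend_self (i₀ : Fin N) {t : ℕ} (ω : History N t) (c : Fin N × Bool) :
    toSeq i₀ (extend ω c) t = c := by
  simp only [toSeq, Nat.lt_succ_self, dif_pos]
  exact Fin.snoc_last (α := fun _ => Fin N × Bool) c ω

open Classical in
/-- The delivery indicators of sub-system `i` along an infinite sequence of slots. -/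
def deliveredSeq (i : Fin N) (γ₀ : Bool) (e : ℕ → Fin N × Bool) (k : ℕ) : Bool :=
  if k = 0 then γ₀
  else decide (∃ s, (k - 1) * W.h i ≤ s ∧ s < k * W.h i ∧ e s = (i, true))

lemma delivered_eq_deliveredSeq (i i₀ : Fin N) (γ₀ : Bool) {t : ℕ} (ω : History N t) :
    W.delivered i γ₀ ω = W.deliveredSeq i γ₀ (toSeq i₀ ω) := by
  funext k
  unfold delivered deliveredSeq
  split_ifs with hk
  · rfl
  · rw [decide_eq_decide]
    constructor
    · rintro ⟨s, h1, h2, h3⟩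
      exact ⟨s, h1, h2, by simpa [toSeq] using h3⟩
    · rintro ⟨s, h1, h2, h3⟩
      by_cases hs : s < t
      · exact ⟨⟨s, hs⟩, h1, h2, by simpa [toSeq, hs] using h3⟩
      · simp [toSeq, hs] at h3

/-! ### The deadbeat controller -/

/-- The control policy `u_k = -(Ā² / B̄) x_k`, which disregards the packet in flight. -/
def deadbeat (i : Fin N) : ControlPolicy where
  K := W.Abar i / W.Bbar i
  q := 1
  q_nonneg := zero_le_one
  q_le_one := le_rfl

section Deadbeat

variable (i : Fin N) (x₁ u₀ : ℝ) (γ : ℕ → Bool)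

lemma closedLoop_succ_fst (c : ControlPolicy) (k : ℕ) :
    (W.closedLoop i c x₁ u₀ γ (k + 1)).1 = W.Abar i * (W.closedLoop i c x₁ u₀ γ k).1 +
      (if γ k = true then 1 else 0) * W.Bbar i * (W.closedLoop i c x₁ u₀ γ k).2 := rfl

lemma deadbeat_succ_snd (k : ℕ) :
    W.Bbar i * (W.closedLoop i (W.deadbeat i) x₁ u₀ γ (k + 1)).2 =
      -(W.Abar i ^ 2 * (W.closedLoop i (W.deadbeat i) x₁ u₀ γ k).1) := by
  have hB := W.Bbar_ne_zero i
  change W.Bbar i * (-(W.Abar i / W.Bbar i) * (W.Abar i * _ + (1 - 1) * _ * _)) = _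
  field_simp
  ring

/-- An isolated delivery steers the closed loop with the deadbeat controller to the origin. -/
lemma deadbeat_eq_zero {m : ℕ} (h1 : γ (m + 1) = false) (h2 : γ (m + 2) = true)
    (h3 : γ (m + 3) = false) {n : ℕ} (hn : m + 3 ≤ n) :
    (W.closedLoop i (W.deadbeat i) x₁ u₀ γ n).1 = 0 := by
  have hB := W.Bbar_ne_zero i
  set P := W.closedLoop i (W.deadbeat i) x₁ u₀ γ with hP
  have e1 : ∀ k, (P (k + 1)).1 = W.Abar i * (P k).1 +
      (if γ k = true then 1 else 0) * (W.Bbar i * (P k).2) := fun k => by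
    rw [hP, closedLoop_succ_fst, mul_assoc]
  have e2 : ∀ k, W.Bbar i * (P (k + 1)).2 = -(W.Abar i ^ 2 * (P k).1) :=
    W.deadbeat_succ_snd i x₁ u₀ γ
  have p2 := e1 (m + 1)
  have p3 := e1 (m + 2)
  have p4 := e1 (m + 3)
  rw [h1] at p2
  rw [h2, e2] at p3
  rw [h3] at p4
  simp only [Bool.false_eq_true, if_false, zero_mul, add_zero, if_true, one_mul] at p2 p3 p4
  -- The control was computed for a state that evolves freely for one period, which `h1` ensures;
  -- the cancellation is then exact.
  have z3 : (P (m + 3)).1 = 0 := by rw [p3, p2]; ring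
  have z4 : (P (m + 4)).1 = 0 := by rw [p4, z3, mul_zero]
  -- Two consecutive zero states persist whatever is delivered later, since each control is a
  -- multiple of the state it was computed from.
  have hall : ∀ k, (P (m + 3 + k)).1 = 0 ∧ (P (m + 3 + (k + 1))).1 = 0 := by
    intro k
    induction k with
    | zero => exact ⟨z3, z4⟩
    | succ k ih =>
      refine ⟨ih.2, ?_⟩
      have := e1 (m + 3 + (k + 1))
      rw [ih.2, mul_zero, zero_add, ← add_assoc (m + 3) k 1, e2, ih.1] at this
      simpa [add_assoc] using this
  obtain ⟨k, rfl⟩ := Nat.exists_eq_add_of_le hn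
  exact (hall k).1

/-- The norm on the states of the closed loop with respect to which a slot without delivery has
gain at most `Ā`. -/
def loopNorm (P : ℝ × ℝ) : ℝ := max |P.1| (|W.Bbar i * P.2| / W.Abar i)

/-- Dividing the control by `Ā` in the norm balances its size `Ā ^ 2 * |x|`. A delivery adds one
more term of size at most `Ā` times the norm, whence the factor 2. -/
lemma loopNorm_deadbeat_succ (k : ℕ) :
    W.loopNorm i (W.closedLoop i (W.deadbeat i) x₁ u₀ γ (k + 1)) ≤
      (if γ k = true then 2 else 1) *
        (W.Abar i * W.loopNorm i (W.closedLoop i (W.deadbeat i) x₁ u₀ γ k)) := by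
  have ha := W.Abar_pos i
  set P := W.closedLoop i (W.deadbeat i) x₁ u₀ γ with hP
  have e1 : (P (k + 1)).1 = W.Abar i * (P k).1 +
      (if γ k = true then 1 else 0) * (W.Bbar i * (P k).2) := by
    rw [hP, closedLoop_succ_fst, mul_assoc]
  have e2 : W.Bbar i * (P (k + 1)).2 = -(W.Abar i ^ 2 * (P k).1) :=
    W.deadbeat_succ_snd i x₁ u₀ γ k
  have n1 : |(P k).1| ≤ W.loopNorm i (P k) := le_max_left _ _
  have n2 : |W.Bbar i * (P k).2| ≤ W.Abar i * W.loopNorm i (P k) := by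
    rw [mul_comm (W.Abar i), ← div_le_iff₀ ha]
    exact le_max_right _ _
  have n3 : W.Abar i * |(P k).1| ≤ W.Abar i * W.loopNorm i (P k) :=
    mul_le_mul_of_nonneg_left n1 ha.le
  have n0 : 0 ≤ W.Abar i * W.loopNorm i (P k) := (abs_nonneg _).trans n2
  refine max_le ?_ ?_
  · rw [e1]
    refine (abs_add_le _ _).trans ?_
    rw [abs_mul, abs_of_pos ha, abs_mul]
    split_ifs
    · rw [abs_one]
      linarith
    · rw [abs_zero]
      linarith
  · rw [e2, abs_neg, abs_mul, abs_of_nonneg (sq_nonneg _), pow_two, mul_assoc,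
      mul_div_cancel_left₀ _ ha.ne']
    refine n3.trans ?_
    split_ifs
    · linarith
    · linarith

end Deadbeat

/-! ### Growth of the deadbeat loop in terms of the number of deliveries -/

/-- The number of deliveries in the first `t` slots. -/
def deliveries (e : ℕ → Fin N × Bool) : ℕ → ℕ
  | 0 => 0
  | t + 1 => deliveries e t + if (e t).2 = true then 1 else 0

lemma deliveries_mono (e : ℕ → Fin N × Bool) : Monotone (deliveries e) :=
  monotone_nat_of_le_succ fun _ => Nat.le_add_right _ _

lemma loopNorm_deadbeat_le (i : Fin N) (x₁ u₀ : ℝ) (γ₀ : Bool) (e : ℕ → Fin N × Bool) (k : ℕ) :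
    W.loopNorm i (W.closedLoop i (W.deadbeat i) x₁ u₀ (W.deliveredSeq i γ₀ e) k) ≤
      2 ^ (1 + deliveries e (k * W.h i)) * (W.Abar i ^ k * W.loopNorm i (x₁, u₀)) := by
  have ha := W.Abar_pos i
  set γ := W.deliveredSeq i γ₀ e with hγ
  set P := W.closedLoop i (W.deadbeat i) x₁ u₀ γ with hP
  have hpos : ∀ Q, 0 ≤ W.loopNorm i Q := fun Q => (abs_nonneg _).trans (le_max_left _ _)
  -- The value at `k + 1` depends on `γ 0, …, γ k` only, hence on the first `k * h i` slots; the
  -- extra factor 2 pays for `γ₀`.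
  have key : ∀ k, W.loopNorm i (P (k + 1)) ≤
      2 ^ (1 + deliveries e (k * W.h i)) * (W.Abar i ^ (k + 1) * W.loopNorm i (x₁, u₀)) := by
    intro k
    induction k with
    | zero =>
      refine (W.loopNorm_deadbeat_succ i x₁ u₀ γ 0).trans ?_
      have h0 : 0 ≤ W.Abar i * W.loopNorm i (P 0) := mul_nonneg ha.le (hpos _)
      simp only [zero_mul, deliveries, add_zero, pow_one, zero_add]
      change _ ≤ 2 * (W.Abar i * W.loopNorm i (P 0))
      split_ifs <;> linarith
    | succ k ih =>
      refine (W.loopNorm_deadbeat_succ i x₁ u₀ γ (k + 1)).trans ?_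
      have h0 : 0 ≤ W.Abar i ^ (k + 1) * W.loopNorm i (x₁, u₀) :=
        mul_nonneg (pow_nonneg ha.le _) (hpos _)
      have hstep : (if γ (k + 1) = true then (2 : ℝ) else 1) * 2 ^ (1 + deliveries e (k * W.h i)) ≤
          2 ^ (1 + deliveries e ((k + 1) * W.h i)) := by
        have hm : k * W.h i ≤ (k + 1) * W.h i := Nat.mul_le_mul_right _ (Nat.le_succ k)
        split_ifs with hd
        · rw [← pow_succ']
          refine pow_le_pow_right₀ one_le_two ?_
          simp only [hγ, deliveredSeq, Nat.succ_ne_zero, if_false, decide_eq_true_eq,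
            Nat.add_sub_cancel] at hd
          obtain ⟨s, h1, h2, h3⟩ := hd
          have m1 := deliveries_mono e h1
          have m2 := deliveries_mono e (Nat.succ_le_of_lt h2)
          have m3 : deliveries e (s + 1) = deliveries e s + 1 := by simp [deliveries, h3]
          rw [Nat.succ_eq_add_one] at m2
          omega
        · rw [one_mul]
          exact pow_le_pow_right₀ one_le_two (by have := deliveries_mono e hm; omega)
      calc (if γ (k + 1) = true then (2 : ℝ) else 1) * (W.Abar i * W.loopNorm i (P (k + 1)))
          ≤ (if γ (k + 1) = true then (2 : ℝ) else 1) * (W.Abar i *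
            (2 ^ (1 + deliveries e (k * W.h i)) *
              (W.Abar i ^ (k + 1) * W.loopNorm i (x₁, u₀)))) := by
            refine mul_le_mul_of_nonneg_left (mul_le_mul_of_nonneg_left ih ha.le) ?_
            split_ifs <;> norm_num
        _ = ((if γ (k + 1) = true then (2 : ℝ) else 1) * 2 ^ (1 + deliveries e (k * W.h i))) *
            (W.Abar i * (W.Abar i ^ (k + 1) * W.loopNorm i (x₁, u₀))) := by ring
        _ ≤ 2 ^ (1 + deliveries e ((k + 1) * W.h i)) *
            (W.Abar i * (W.Abar i ^ (k + 1) * W.loopNorm i (x₁, u₀))) :=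
            mul_le_mul_of_nonneg_right hstep (mul_nonneg ha.le h0)
        _ = _ := by ring
  cases k with
  | zero =>
    simp only [zero_mul, deliveries, add_zero, pow_one, pow_zero, one_mul]
    change W.loopNorm i (x₁, u₀) ≤ _
    linarith [hpos (x₁, u₀)]
  | succ k =>
    refine (key k).trans (mul_le_mul_of_nonneg_right (pow_le_pow_right₀ one_le_two ?_)
      (mul_nonneg (pow_nonneg ha.le _) (hpos _)))
    have := deliveries_mono e (Nat.mul_le_mul_right (W.h i) (Nat.le_succ k))
    rw [Nat.succ_eq_add_one] at this
    omega

/-! ### The sequential scheduling policy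

The sub-systems `tgt 0, tgt 1, …` are served one after the other.  Serving `tgt j` takes four stages:
in stage `4 * j` another sub-system transmits until the end of the frame, in stage `4 * j + 1`
sub-system `tgt j` transmits until a packet is delivered, and in the stages `4 * j + 2`, `4 * j + 3`
another sub-system transmits until the end of the frame. -/

/-- The stage after a slot `t + 1` with stage `s`, where `d` tells whether a packet was delivered. -/
def nextStage (H t s : ℕ) (d : Bool) : ℕ :=
  if s % 4 = 1 then (if d = true then s + 1 else s) else if H ∣ t + 1 then s + 1 else s

/-- The stage after `t` slots. -/
def stage (H : ℕ) (e : ℕ → Fin N × Bool) : ℕ → ℕ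
  | 0 => 0
  | t + 1 => nextStage H t (stage H e t) (e t).2

lemma stage_congr {H : ℕ} {e e' : ℕ → Fin N × Bool} {t : ℕ} (h : ∀ s < t, e s = e' s) :
    stage H e t = stage H e' t := by
  induction t with
  | zero => rfl
  | succ t ih => rw [stage, stage, ih fun s hs => h s (by omega), h t (by omega)]

lemma stage_extend (H : ℕ) (i₀ : Fin N) {t : ℕ} (ω : History N t) (c : Fin N × Bool) :
    stage H (toSeq i₀ (extend ω c)) (t + 1) = nextStage H t (stage H (toSeq i₀ ω) t) c.2 := by
  rw [stage, toSeq_extend_self, stage_congr fun s hs => toSeq_extend_of_lt i₀ ω c hs]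

lemma le_nextStage (H t s : ℕ) (d : Bool) : s ≤ nextStage H t s d := by
  unfold nextStage
  split_ifs <;> omega

lemma nextStage_le (H t s : ℕ) (d : Bool) : nextStage H t s d ≤ s + 1 := by
  unfold nextStage
  split_ifs <;> omega

lemma stage_mono (H : ℕ) (e : ℕ → Fin N × Bool) : Monotone (stage H e) :=
  monotone_nat_of_le_succ fun _ => le_nextStage _ _ _ _

lemma exists_stage_exit (H : ℕ) (e : ℕ → Fin N × Bool) {n T : ℕ} (h : n + 1 ≤ stage H e T) :
    ∃ t < T, stage H e t = n ∧ stage H e (t + 1) = n + 1 := by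
  induction T with
  | zero => simp [stage] at h
  | succ T ih =>
    by_cases hT : n + 1 ≤ stage H e T
    · obtain ⟨t, ht, h'⟩ := ih hT
      exact ⟨t, by omega, h'⟩
    · have : stage H e (T + 1) ≤ stage H e T + 1 := nextStage_le _ _ _ _
      exact ⟨T, by omega, by omega, by omega⟩

lemma dvd_of_stage_exit {H : ℕ} {e : ℕ → Fin N × Bool} {n t : ℕ} (hn : n % 4 ≠ 1)
    (h0 : stage H e t = n) (h1 : stage H e (t + 1) = n + 1) : H ∣ t + 1 := by
  rw [stage, h0, nextStage, if_neg hn] at h1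
  by_contra h
  rw [if_neg h] at h1
  omega

lemma exists_stage_start (H : ℕ) (e : ℕ → Fin N × Bool) {j T : ℕ} (h : 4 * j ≤ stage H e T) :
    ∃ t ≤ T, stage H e t = 4 * j ∧ H ∣ t := by
  cases j with
  | zero => exact ⟨0, Nat.zero_le _, rfl, dvd_zero _⟩
  | succ j =>
    obtain ⟨t, ht, h0, h1⟩ := exists_stage_exit H e (n := 4 * j + 3) (T := T) (by omega)
    exact ⟨t + 1, ht, by omega, dvd_of_stage_exit (by omega) h0 h1⟩

/-- The sub-system that transmits in stage `s`. -/
def stageAction (tgt : ℕ → Fin N) (idle : Fin N → Fin N) (s : ℕ) : Fin N :=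
  if s % 4 = 1 then tgt (s / 4) else idle (tgt (s / 4))

/-- The sub-system that the sequential policy chooses after a history. -/
def sequentialAction (H : ℕ) (tgt : ℕ → Fin N) (idle : Fin N → Fin N) (t : ℕ) (ω : History N t) :
    Fin N :=
  stageAction tgt idle (stage H (toSeq (tgt 0) ω) t)

/-- The stage is defined for arbitrary slot sequences; only on the support of the law do the actions
follow it. -/
lemma action_of_mem_support (H : ℕ) (tgt : ℕ → Fin N) (idle : Fin N → Fin N) {t : ℕ}
    {ω : History N t}
    (h : W.historyLaw (detPolicy (sequentialAction H tgt idle)) t ω ≠ 0) {s : ℕ} (hs : s < t) :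
    (toSeq (tgt 0) ω s).1 = stageAction tgt idle (stage H (toSeq (tgt 0) ω) s) := by
  induction t with
  | zero => omega
  | succ t ih =>
    obtain ⟨ω', d, h', rfl⟩ := W.mem_support_historyLaw _ h
    have hc : ∀ r ≤ t, stage H (toSeq (tgt 0)
        (extend ω' (sequentialAction H tgt idle t ω', d))) r = stage H (toSeq (tgt 0) ω') r :=
      fun r hr => stage_congr fun u hu => toSeq_extend_of_lt _ _ _ (by omega)
    rw [hc s (by omega)]
    rcases Nat.lt_succ_iff_lt_or_eq.1 hs with hs' | rfl
    · rw [toSeq_extend_of_lt _ _ _ hs']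
      exact ih h' hs'
    · rw [toSeq_extend_self]
      rfl

/-- Once sub-system `tgt j` has been served, its state is zero. -/
lemma closedLoop_eq_zero_of_stage {tgt : ℕ → Fin N} {idle : Fin N → Fin N}
    (hidle : ∀ i, idle i ≠ i) {e : ℕ → Fin N × Bool} {j k : ℕ}
    (he : ∀ s < k * W.h (tgt j), (e s).1 = stageAction tgt idle (stage W.H e s))
    (hst : 4 * (j + 1) ≤ stage W.H e (k * W.h (tgt j))) (x₁ u₀ : ℝ) (γ₀ : Bool) :
    (W.closedLoop (tgt j) (W.deadbeat (tgt j)) x₁ u₀ (W.deliveredSeq (tgt j) γ₀ e) k).1 = 0 := by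
  set i := tgt j with hi
  set T := k * W.h i with hT
  have hh := W.h_pos i
  have hmono := stage_mono W.H e
  have lt_of : ∀ {s t : ℕ}, stage W.H e s < stage W.H e t → s < t := fun h => hmono.reflect_lt h
  obtain ⟨t0, -, s0, d0⟩ := exists_stage_start W.H e (j := j) (T := T) (by omega)
  obtain ⟨v0, hv0, a0, b0⟩ := exists_stage_exit W.H e (n := 4 * j) (T := T) (by omega)
  obtain ⟨v1, hv1, a1, b1⟩ := exists_stage_exit W.H e (n := 4 * j + 1) (T := T) (by omega)
  obtain ⟨v2, hv2, a2, b2⟩ := exists_stage_exit W.H e (n := 4 * j + 2) (T := T) (by omega)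
  obtain ⟨v3, hv3, a3, b3⟩ := exists_stage_exit W.H e (n := 4 * j + 3) (T := T) (by omega)
  have hd := W.h_dvd_H i
  obtain ⟨m0, e0⟩ := hd.trans d0
  obtain ⟨m1, e1⟩ := hd.trans (dvd_of_stage_exit (by omega) a0 b0)
  obtain ⟨m3, e3⟩ := hd.trans (dvd_of_stage_exit (by omega) a2 b2)
  obtain ⟨m4, e4⟩ := hd.trans (dvd_of_stage_exit (by omega) a3 b3)
  have o1 : t0 < v0 + 1 := lt_of (by omega)
  have o2 : v0 < v1 := lt_of (by omega)
  have o3 : v1 < v2 := lt_of (by omega)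
  have o4 : v2 < v3 := lt_of (by omega)
  have hidle' : ∀ s < T, stage W.H e s / 4 = j → stage W.H e s % 4 ≠ 1 → e s ≠ (i, true) := by
    intro s hs h1 h2 h3
    have := he s hs
    rw [h3, stageAction, if_neg h2, h1] at this
    exact hidle i this.symm
  have hack : (e v1).2 = true := by
    rw [stage, a1, nextStage, if_pos (by omega)] at b1
    by_contra h
    rw [if_neg h] at b1
    omega
  have hv1' : e v1 = (i, true) := by
    have := he v1 hv1
    rw [a1, stageAction, if_pos (by omega), show (4 * j + 1) / 4 = j by omega] at this
    exact Prod.ext this hack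
  -- Up to `v0` another sub-system transmits; from `v0 + 1` on, the serving stage would have ended
  -- with any earlier delivery.
  have hbefore : ∀ s, t0 ≤ s → s < v1 → e s ≠ (i, true) := by
    intro s h1 h2
    have l1 := hmono h1
    by_cases hs : s ≤ v0
    · have l2 := hmono hs
      exact hidle' s (by omega) (by omega) (by omega)
    · intro h3
      have l2 := hmono (show v0 + 1 ≤ s by omega)
      have l3 := hmono (show s + 1 ≤ v1 by omega)
      have l4 := hmono h2.le
      rw [stage, show stage W.H e s = 4 * j + 1 by omega, nextStage, if_pos (by omega), h3] at l3
      simp only [if_true] at l3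
      omega
  have hafter : ∀ s, v1 < s → s ≤ v3 → e s ≠ (i, true) := by
    intro s h1 h2
    have l1 := hmono (show v1 + 1 ≤ s by omega)
    have l2 := hmono h2
    exact hidle' s (by omega) (by omega) (by omega)
  have hm01 : m0 < m1 := lt_of_mul_lt_mul_left (show W.h i * m0 < W.h i * m1 by omega) (Nat.zero_le _)
  have hm34 : m3 < m4 := lt_of_mul_lt_mul_left (show W.h i * m3 < W.h i * m4 by omega) (Nat.zero_le _)
  -- The delivery in slot index `v1` falls into period `c + 1`. The frame before and the frame after
  -- are idle and contain the whole neighbouring periods; in particular `c ≥ 1`.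
  obtain ⟨c, hc⟩ : ∃ c, c = v1 / W.h i := ⟨_, rfl⟩
  have c1 : c * W.h i ≤ v1 := by rw [hc]; exact Nat.div_mul_le_self _ _
  have c2 : v1 < (c + 1) * W.h i := by
    rw [hc, mul_comm]; exact Nat.lt_mul_div_succ _ hh
  have hm1c : m1 ≤ c := by
    rw [hc, Nat.le_div_iff_mul_le hh, mul_comm]; omega
  have hm3c : c + 1 ≤ m3 := by
    by_contra h
    have := Nat.mul_le_mul_left (W.h i) (show m3 ≤ c by omega)
    rw [mul_comm _ c] at this
    omega
  have hm4k : m4 ≤ k := by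
    refine le_of_mul_le_mul_left (?_ : W.h i * m4 ≤ W.h i * k) hh
    rw [mul_comm _ k]
    omega
  obtain ⟨m, rfl⟩ : ∃ m, c = m + 1 := ⟨c - 1, by omega⟩
  have g0 : m0 * W.h i ≤ m * W.h i := Nat.mul_le_mul_right _ (by omega)
  have g4 : (m + 3) * W.h i ≤ m4 * W.h i := Nat.mul_le_mul_right _ (by omega)
  rw [mul_comm] at e0 e4
  refine W.deadbeat_eq_zero i x₁ u₀ _ (m := m) ?_ ?_ ?_ (by omega)
  · simp only [deliveredSeq, Nat.succ_ne_zero, if_false, decide_eq_false_iff_not]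
    rintro ⟨s, h1, h2, h3⟩
    rw [Nat.add_sub_cancel] at h1
    exact hbefore s (by omega) (by omega) h3
  · simp only [deliveredSeq, Nat.succ_ne_zero, if_false, decide_eq_true_eq]
    exact ⟨v1, c1, c2, hv1'⟩
  · simp only [deliveredSeq, Nat.succ_ne_zero, if_false, decide_eq_false_iff_not]
    rintro ⟨s, h1, h2, h3⟩
    exact hafter s (lt_of_lt_of_le c2 h1) (by omega) h3

/-- A serving stage ends with its only delivery, and an idle stage ends with the current frame, so
it contains at most `H` slots. The term `t % H` counts the slots of the unfinished frame. -/
lemma deliveries_le_of_stage {H : ℕ} (hH : 0 < H) (e : ℕ → Fin N × Bool) (t : ℕ) :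
    deliveries e t ≤ (H + 1) * stage H e t + if stage H e t % 4 = 1 then 0 else t % H := by
  induction t with
  | zero => simp [deliveries]
  | succ t ih =>
    rw [deliveries, stage]
    generalize stage H e t = s at ih ⊢
    have hs : (H + 1) * (s + 1) = (H + 1) * s + H + 1 := by ring
    have hlt := Nat.mod_lt t hH
    unfold nextStage
    by_cases h1 : s % 4 = 1
    · rw [if_pos h1] at ih
      by_cases hd : (e t).2 = true
      · simp only [h1, hd, if_true]
        omega
      · simp only [h1, hd, if_true]
        simpa [h1] using ih
    · rw [if_neg h1] at ih
      have hd : (if (e t).2 = true then 1 else 0) ≤ 1 := by split_ifs <;> omega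
      by_cases hH' : H ∣ t + 1
      · simp only [h1, hH', if_true, if_false]
        omega
      · simp only [h1, hH', if_false]
        have hmod : (t + 1) % H = t % H + 1 := by
          have h2 : t % H + 1 ≠ H := fun h => hH' (by
            rw [← Nat.div_add_mod t H, add_assoc, h]
            exact (Dvd.intro _ rfl).add dvd_rfl)
          rw [← Nat.mod_eq_of_lt (show t % H + 1 < H by omega), Nat.mod_add_mod]
        omega

/-- At the beginning of stage `4 * j + 1` the packets are new, and none is delivered before its
end. -/
lemma packetState_of_stage (i₀ : Fin N) {t : ℕ} (ω : History N t)
    (h : stage W.H (toSeq i₀ ω) t % 4 = 1) (i : Fin N) : W.packetState ω i = true := by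
  -- A serving stage is entered only at a frame boundary, where every packet is new, and is left at
  -- its first delivery.
  have key : ∀ (e : ℕ → Fin N × Bool) (t : ℕ), stage W.H e t % 4 = 1 →
      ∃ t₀ ≤ t, W.H ∣ t₀ ∧ ∀ s, t₀ ≤ s → s < t → (e s).2 = false := by
    intro e t
    induction t with
    | zero => intro h; simp [stage] at h
    | succ t ih =>
      intro h
      rw [stage, nextStage] at h
      by_cases h1 : stage W.H e t % 4 = 1
      · rw [if_pos h1] at h
        have hd : (e t).2 = false := by
          by_contra hd
          rw [if_pos (by simpa using hd)] at h
          omega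
        obtain ⟨t₀, h2, h3, h4⟩ := ih h1
        refine ⟨t₀, by omega, h3, fun s h5 h6 => ?_⟩
        rcases Nat.lt_succ_iff_lt_or_eq.1 h6 with h7 | rfl
        · exact h4 s h5 h7
        · exact hd
      · rw [if_neg h1] at h
        have hH : W.H ∣ t + 1 := by
          by_contra hH
          rw [if_neg hH] at h
          exact h1 h
        exact ⟨t + 1, le_rfl, hH, fun s _ _ => by omega⟩
  obtain ⟨t₀, h1, h2, h3⟩ := key _ _ h
  obtain ⟨m, hm⟩ := (W.h_dvd_H i).trans h2
  simp only [packetState, decide_eq_true_eq]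
  intro s hs hω
  have h4 : m ≤ t / W.h i := by
    rw [Nat.le_div_iff_mul_le (W.h_pos i), mul_comm]
    omega
  have h5 : t₀ ≤ s := by
    rw [hm, mul_comm]
    exact (Nat.mul_le_mul_right _ (hs ▸ h4)).trans (Nat.div_mul_le_self _ _)
  have h6 := h3 s h5 s.2
  simp [toSeq, hω] at h6

/-! ### Exponential tail of the time needed to serve a target -/

/-- A potential that bounds the probability that the stage is still less than `S`. -/
def stagePotential (θ ρ : ℝ) (H S s t : ℕ) : ℝ :=
  if s < S then θ ^ s * (if s % 4 = 1 then 1 else ρ ^ (t % H)) else 0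

section Potential

variable {θ ρ : ℝ} {H S : ℕ}

lemma stagePotential_nonneg (hθ : 0 < θ) (hρ : 0 < ρ) (s t : ℕ) :
    0 ≤ stagePotential θ ρ H S s t := by
  unfold stagePotential
  split_ifs <;> positivity

lemma stagePotential_le (hθ : 0 < θ) (hρ : 0 < ρ) (hρ1 : ρ ≤ 1) (s t : ℕ) :
    stagePotential θ ρ H S s t ≤ θ ^ s := by
  unfold stagePotential
  split_ifs
  · rw [mul_one]
  · exact mul_le_of_le_one_right (by positivity) (pow_le_one₀ hρ.le hρ1)
  · positivity

lemma le_stagePotential (hθ : 0 < θ) (hθ1 : θ ≤ 1) (hρ : 0 < ρ) (hρ1 : ρ ≤ 1) (hH : 0 < H)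
    {s : ℕ} (hs : s < S) (t : ℕ) : θ ^ S * ρ ^ H ≤ stagePotential θ ρ H S s t := by
  rw [stagePotential, if_pos hs]
  refine mul_le_mul (pow_le_pow_of_le_one hθ.le hθ1 hs.le) ?_ (by positivity) (by positivity)
  split_ifs
  · exact pow_le_one₀ hρ.le hρ1
  · exact pow_le_pow_of_le_one hρ.le hρ1 (Nat.mod_lt t hH).le

/-- In an idle stage, the potential decreases by the factor `ρ` in each slot. -/
lemma stagePotential_nextStage_idle (hθ : 0 < θ) (hρ : 0 < ρ) (hρ1 : ρ ≤ 1) (hH : 0 < H)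
    (hθρ : θ ≤ ρ ^ H) {s : ℕ} (hs : s % 4 ≠ 1) (t : ℕ) (d : Bool) :
    stagePotential θ ρ H S (nextStage H t s d) (t + 1) ≤ ρ * stagePotential θ ρ H S s t := by
  by_cases hS : s < S
  · rw [nextStage, if_neg hs]
    have hlt := Nat.mod_lt t hH
    have h2 : stagePotential θ ρ H S s t = θ ^ s * ρ ^ (t % H) := by
      rw [stagePotential, if_pos hS, if_neg hs]
    by_cases hd : H ∣ t + 1
    · rw [if_pos hd, h2]
      refine (stagePotential_le hθ hρ hρ1 _ _).trans ?_
      calc θ ^ (s + 1) = θ ^ s * θ := pow_succ _ _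
        _ ≤ θ ^ s * ρ ^ H := mul_le_mul_of_nonneg_left hθρ (by positivity)
        -- Advancing the stage pays the factor `θ ≤ ρ ^ H` at once, which covers the loss of the
        -- accumulated powers of `ρ`.
        _ ≤ θ ^ s * ρ ^ (t % H + 1) := mul_le_mul_of_nonneg_left
            (pow_le_pow_of_le_one hρ.le hρ1 (by omega)) (by positivity)
        _ = ρ * (θ ^ s * ρ ^ (t % H)) := by ring
    · have h3 : t % H + 1 ≠ H := fun h => hd (by
        rw [← Nat.div_add_mod t H, add_assoc, h]
        exact (Dvd.intro _ rfl).add dvd_rfl)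
      have h4 : (t + 1) % H = t % H + 1 := by
        rw [← Nat.mod_add_mod, Nat.mod_eq_of_lt (show t % H + 1 < H by omega)]
      rw [if_neg hd, h2, stagePotential, if_pos hS, if_neg hs, h4]
      exact le_of_eq (by ring)
  · have h1 := le_nextStage H t s d
    rw [stagePotential, stagePotential, if_neg hS, if_neg (by omega), mul_zero]

/-- In a serving stage, the potential decreases by the factor `ρ` on average. -/
lemma stagePotential_nextStage_serve (hθ : 0 < θ) (hρ : 0 < ρ) (hρ1 : ρ ≤ 1) {s : ℕ}
    (hs : s % 4 = 1) {p : ℝ} (hp : 0 ≤ p) (hp1 : p ≤ 1) (hθp : s < S → θ ≤ ρ - (1 - p)) (t : ℕ) :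
    p * stagePotential θ ρ H S (nextStage H t s true) (t + 1) +
        (1 - p) * stagePotential θ ρ H S (nextStage H t s false) (t + 1) ≤
      ρ * stagePotential θ ρ H S s t := by
  rw [nextStage, nextStage, if_pos hs, if_pos hs, if_pos rfl, if_neg (by decide)]
  by_cases hS : s < S
  · have h2 : ∀ t, stagePotential θ ρ H S s t = θ ^ s := fun t => by
      rw [stagePotential, if_pos hS, if_pos hs, mul_one]
    rw [h2, h2]
    have h3 := mul_le_mul_of_nonneg_left
      (stagePotential_le (H := H) (S := S) hθ hρ hρ1 (s + 1) (t + 1)) hp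
    have h4 : p * θ ^ (s + 1) ≤ θ ^ s * θ := by
      rw [pow_succ]
      exact mul_le_of_le_one_left (by positivity) hp1
    have h5 : θ ^ s * θ ≤ θ ^ s * (ρ - (1 - p)) :=
      mul_le_mul_of_nonneg_left (hθp hS) (by positivity)
    linarith
  · simp only [stagePotential, hS, show ¬ s + 1 < S by omega, if_false, mul_zero, add_zero, le_refl]

end Potential

/-- The potential is a supermartingale up to the factor `ρ` per slot. In serving stages the success
probability is exactly that of the target, because its packet is pending; in idle stages the bound
holds for either outcome. -/
lemma expect_stagePotential_le {θ ρ : ℝ} {S : ℕ} (hθ : 0 < θ) (hρ : 0 < ρ) (hρ1 : ρ ≤ 1)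
    (hθρ : θ ≤ ρ ^ W.H) {tgt : ℕ → Fin N} (idle : Fin N → Fin N)
    (hθp : ∀ s < S, θ ≤ ρ - (1 - W.p (tgt (s / 4)))) (t : ℕ) :
    W.expect (detPolicy (sequentialAction W.H tgt idle)) t
      (fun ω => stagePotential θ ρ W.H S (stage W.H (toSeq (tgt 0) ω) t) t) ≤ ρ ^ t := by
  induction t with
  | zero =>
    rw [expect_zero, pow_zero]
    exact stagePotential_le hθ hρ hρ1 0 0
  | succ t ih =>
    rw [expect_succ, pow_succ']
    refine le_trans ?_ (mul_le_mul_of_nonneg_left ih hρ.le)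
    rw [← expect_const_mul]
    refine W.expect_mono _ _ fun ω => ?_
    simp only [stage_extend]
    set s := stage W.H (toSeq (tgt 0) ω) t with hs
    have hq0 := W.successProb_nonneg (W.packetState ω) (sequentialAction W.H tgt idle t ω)
    have hq1 := W.successProb_le_one (W.packetState ω) (sequentialAction W.H tgt idle t ω)
    by_cases h1 : s % 4 = 1
    · have hact : sequentialAction W.H tgt idle t ω = tgt (s / 4) := by
        rw [sequentialAction, stageAction, if_pos h1]
      have hsp : W.successProb (W.packetState ω) (sequentialAction W.H tgt idle t ω) =
          W.p (tgt (s / 4)) := by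
        rw [successProb, W.packetState_of_stage (tgt 0) ω h1, if_pos rfl, hact]
      rw [hsp] at hq0 hq1 ⊢
      exact stagePotential_nextStage_serve hθ hρ hρ1 h1 hq0 hq1 (hθp s) t
    · have h2 := fun d => stagePotential_nextStage_idle (S := S) hθ hρ hρ1 W.H_pos hθρ h1 t d
      have h3 := mul_le_mul_of_nonneg_left (h2 true) hq0
      have h4 := mul_le_mul_of_nonneg_left (h2 false) (sub_nonneg.2 hq1)
      linarith

lemma Abar_sq (i : Fin N) : W.Abar i ^ 2 = Real.exp (2 * W.A i * W.Δ) ^ W.h i := by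
  rw [Abar, ← Real.exp_nat_mul, ← Real.exp_nat_mul]
  congr 1
  push_cast
  ring

/-- The sequential policy stabilizes `tgt j` if `tgt 0, …, tgt j` are delivered fast enough. -/
lemma meanSquareStable_sequential {tgt : ℕ → Fin N} {idle : Fin N → Fin N}
    (hidle : ∀ i, idle i ≠ i) (j : ℕ)
    (hp : ∀ j' ≤ j, 1 - W.p (tgt j') < Real.exp (-(2 * W.A (tgt j) * W.Δ))) :
    W.MeanSquareStable (detPolicy (sequentialAction W.H tgt idle)) (W.deadbeat (tgt j))
      (tgt j) := by
  intro x₁ u₀ γ₀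
  set i := tgt j with hi
  set π := detPolicy (sequentialAction W.H tgt idle) with hπ
  set E := Real.exp (-(2 * W.A i * W.Δ)) with hE
  have hE1 : E ≤ 1 := Real.exp_le_one_iff.2 (by
    have := mul_nonneg (W.A_nonneg i) W.Δ_pos.le
    linarith)
  -- `M` is the largest failure probability among the targets up to `j`; a finite maximum stays
  -- strictly below `E`, so some `ρ` fits between.
  obtain ⟨M, hM0, hME, hM⟩ : ∃ M, 0 ≤ M ∧ M < E ∧ ∀ j' ≤ j, 1 - W.p (tgt j') ≤ M := by
    obtain ⟨j', hj', hmax⟩ := Finset.exists_max_image (Finset.range (j + 1))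
      (fun j' => 1 - W.p (tgt j')) ⟨0, by simp⟩
    rw [Finset.mem_range, Nat.lt_succ_iff] at hj'
    refine ⟨1 - W.p (tgt j'), by linarith [W.p_le_one (tgt j')], hp j' hj', fun j'' h => ?_⟩
    exact hmax j'' (Finset.mem_range.2 (by omega))
  obtain ⟨ρ, hMρ, hρE⟩ := exists_between hME
  have hρ : 0 < ρ := hM0.trans_lt hMρ
  have hρ1 : ρ ≤ 1 := hρE.le.trans hE1
  set θ := min (ρ ^ W.H) (ρ - M) with hθ'
  have hθ : 0 < θ := lt_min (by positivity) (by linarith)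
  have hθ1 : θ ≤ 1 := (min_le_left _ _).trans (pow_le_one₀ hρ.le hρ1)
  set S := 4 * (j + 1) with hS
  set C := 2 ^ (1 + ((W.H + 1) * S + W.H)) * W.loopNorm i (x₁, u₀) with hC
  have ha := W.Abar_pos i
  have hb0 : 0 ≤ W.loopNorm i (x₁, u₀) := (abs_nonneg _).trans (le_max_left _ _)
  have hC0 : 0 ≤ C := by positivity
  have hbound : ∀ k, W.secondMoment π (W.deadbeat i) i x₁ u₀ γ₀ k ≤
      C ^ 2 * (θ ^ S * ρ ^ W.H)⁻¹ * (W.Abar i ^ 2 * ρ ^ W.h i) ^ k := by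
    intro k
    set T := k * W.h i with hT
    have hpt : ∀ ω : History N T, W.historyLaw π T ω ≠ 0 →
        |(W.closedLoop i (W.deadbeat i) x₁ u₀ (W.delivered i γ₀ ω) k).1| ^ 2 ≤
          (C ^ 2 * (W.Abar i ^ 2) ^ k * (θ ^ S * ρ ^ W.H)⁻¹) *
            stagePotential θ ρ W.H S (stage W.H (toSeq (tgt 0) ω) T) T := by
      intro ω hω
      rw [W.delivered_eq_deliveredSeq i (tgt 0)]
      set e := toSeq (tgt 0) ω with he
      -- Before completion, the deterministic growth bound applies and the potential is bounded
      -- below; after completion, the state vanishes.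
      by_cases hst : stage W.H e T < S
      · have h1 := W.loopNorm_deadbeat_le i x₁ u₀ γ₀ e k
        have h2 := deliveries_le_of_stage W.H_pos e T
        have h3 : deliveries e T ≤ (W.H + 1) * S + W.H := by
          have h4 := Nat.mul_le_mul_left (W.H + 1) hst.le
          have h5 := Nat.mod_lt T W.H_pos
          split_ifs at h2 <;> omega
        have h4 : |(W.closedLoop i (W.deadbeat i) x₁ u₀ (W.deliveredSeq i γ₀ e) k).1| ≤
            C * W.Abar i ^ k := by
          refine (le_max_left _ _).trans (h1.trans ?_)
          calc _ ≤ 2 ^ (1 + ((W.H + 1) * S + W.H)) * (W.Abar i ^ k * W.loopNorm i (x₁, u₀)) :=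
                mul_le_mul_of_nonneg_right (pow_le_pow_right₀ one_le_two (by rw [← hT]; omega))
                  (by positivity)
            _ = _ := by rw [hC]; ring
        have h5 := le_stagePotential hθ hθ1 hρ hρ1 W.H_pos hst T
        calc _ ≤ (C * W.Abar i ^ k) ^ 2 := pow_le_pow_left₀ (abs_nonneg _) h4 2
          _ = (C ^ 2 * (W.Abar i ^ 2) ^ k * (θ ^ S * ρ ^ W.H)⁻¹) * (θ ^ S * ρ ^ W.H) := by
              rw [mul_assoc _ (θ ^ S * ρ ^ W.H)⁻¹, inv_mul_cancel₀ (by positivity)]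
              ring
          _ ≤ _ := mul_le_mul_of_nonneg_left h5 (by positivity)
      · rw [W.closedLoop_eq_zero_of_stage hidle (e := e)
          (fun s hs => W.action_of_mem_support W.H tgt idle hω hs) (not_lt.1 hst)]
        rw [abs_zero, zero_pow two_ne_zero]
        exact mul_nonneg (by positivity) (stagePotential_nonneg hθ hρ _ _)
    calc W.secondMoment π (W.deadbeat i) i x₁ u₀ γ₀ k
        = W.expect π T fun ω =>
            |(W.closedLoop i (W.deadbeat i) x₁ u₀ (W.delivered i γ₀ ω) k).1| ^ 2 := rfl
      _ ≤ _ := W.expect_mono_of_support π T hpt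
      _ = _ := W.expect_const_mul π T _ _
      _ ≤ (C ^ 2 * (W.Abar i ^ 2) ^ k * (θ ^ S * ρ ^ W.H)⁻¹) * ρ ^ T := by
          refine mul_le_mul_of_nonneg_left ?_ (by positivity)
          refine W.expect_stagePotential_le hθ hρ hρ1 (min_le_left _ _) idle (fun s hs => ?_) T
          have := hM (s / 4) (by omega)
          exact (min_le_right _ _).trans (by linarith)
      _ = _ := by
          rw [hT, mul_pow, mul_comm k, pow_mul]
          ring
  have hr0 : 0 ≤ W.Abar i ^ 2 * ρ ^ W.h i := by positivity
  have hr1 : W.Abar i ^ 2 * ρ ^ W.h i < 1 := by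
    rw [W.Abar_sq, ← mul_pow]
    refine pow_lt_one₀ (by positivity) ?_ (W.h_pos i).ne'
    calc Real.exp (2 * W.A i * W.Δ) * ρ < Real.exp (2 * W.A i * W.Δ) * E :=
          mul_lt_mul_of_pos_left hρE (Real.exp_pos _)
      _ = 1 := by rw [hE, ← Real.exp_add, add_neg_cancel, Real.exp_zero]
  refine squeeze_zero (fun k => ?_) hbound ?_
  · exact W.expect_nonneg π _ fun ω => by positivity
  · simpa using (tendsto_pow_atTop_nhds_zero_of_lt_one hr0 hr1).const_mul _

/-- If there are at least two sub-systems, the system can be stabilized as soon as each sub-system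
can be stabilized by permanent service. -/
lemma canBeStabilized_of_nontrivial [Nontrivial (Fin N)]
    (h : ∀ i, 1 - W.p i < Real.exp (-(2 * W.A i * W.Δ))) : W.CanBeStabilized := by
  have hN : 0 < N := (Classical.arbitrary (Fin N)).pos
  choose idle hidle using fun i : Fin N => exists_ne i
  -- Fast plants go first: a target then waits only for sub-systems whose failure probability is
  -- below its own threshold.
  set σ := Tuple.sort fun i => -W.A i with hσ
  have hsort : Monotone ((fun i => -W.A i) ∘ σ) := Tuple.monotone_sort _
  set tgt : ℕ → Fin N := fun j => if hj : j < N then σ ⟨j, hj⟩ else σ ⟨0, hN⟩ with htgt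
  refine ⟨detPolicy (sequentialAction W.H tgt idle), W.deadbeat, fun i => ?_⟩
  have hi : tgt (σ.symm i) = i := by simp [htgt]
  suffices hp : ∀ j ≤ (σ.symm i : ℕ), 1 - W.p (tgt j) < Real.exp (-(2 * W.A i * W.Δ)) by
    have := W.meanSquareStable_sequential (tgt := tgt) hidle (σ.symm i) (by rwa [hi])
    rwa [hi] at this
  intro j hj
  have hjN : j < N := hj.trans_lt (σ.symm i).2
  refine (h _).trans_le (Real.exp_le_exp.2 ?_)
  have h1 := hsort (show (⟨j, hjN⟩ : Fin N) ≤ σ.symm i from hj)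
  simp only [Function.comp_apply, Equiv.apply_symm_apply, neg_le_neg_iff] at h1
  have h2 : tgt j = σ ⟨j, hjN⟩ := by simp [htgt, hjN]
  rw [h2]
  have := mul_le_mul_of_nonneg_right h1 W.Δ_pos.le
  linarith

/-! ### Permanent service of one sub-system -/

/-- One step of the closed loop. -/
def loopStep (i : Fin N) (c : ControlPolicy) (P : ℝ × ℝ) (g : Bool) : ℝ × ℝ :=
  (W.Abar i * P.1 + (if g = true then 1 else 0) * W.Bbar i * P.2,
    -c.K * W.predictedState i c P.1 P.2)

lemma closedLoop_succ (i : Fin N) (c : ControlPolicy) (x₁ u₀ : ℝ) (γ : ℕ → Bool) (k : ℕ) :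
    W.closedLoop i c x₁ u₀ γ (k + 1) = W.loopStep i c (W.closedLoop i c x₁ u₀ γ k) (γ k) := rfl

lemma closedLoop_congr (i : Fin N) (c : ControlPolicy) (x₁ u₀ : ℝ) {γ γ' : ℕ → Bool} {k : ℕ}
    (h : ∀ m < k, γ m = γ' m) : W.closedLoop i c x₁ u₀ γ k = W.closedLoop i c x₁ u₀ γ' k := by
  induction k with
  | zero => rfl
  | succ k ih => rw [closedLoop_succ, closedLoop_succ, ih fun m hm => h m (by omega), h k (by omega)]

lemma delivered_succ_iff (i i₀ : Fin N) (γ₀ : Bool) {t : ℕ} (ω : History N t) (k : ℕ) :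
    W.delivered i γ₀ ω (k + 1) = true ↔
      ∃ s, k * W.h i ≤ s ∧ s < (k + 1) * W.h i ∧ toSeq i₀ ω s = (i, true) := by
  rw [W.delivered_eq_deliveredSeq i i₀, deliveredSeq, if_neg (Nat.succ_ne_zero k)]
  simp only [decide_eq_true_eq, Nat.add_sub_cancel]

lemma delivered_extend_of_le (i : Fin N) (γ₀ : Bool) {t : ℕ} (ω : History N t) (c : Fin N × Bool)
    {k : ℕ} (hk : k * W.h i ≤ t) :
    W.delivered i γ₀ (extend ω c) k = W.delivered i γ₀ ω k := by
  cases k with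
  | zero => rfl
  | succ k =>
    rw [Bool.eq_iff_iff, W.delivered_succ_iff i i, W.delivered_succ_iff i i]
    refine exists_congr fun s => and_congr_right fun h1 => and_congr_right fun h2 => ?_
    rw [toSeq_extend_of_lt _ _ _ (h2.trans_le hk)]

lemma delivered_extend (i : Fin N) (γ₀ : Bool) {t : ℕ} (ω : History N t) (d : Bool) {k : ℕ}
    (hk : k * W.h i ≤ t) (hk' : t < (k + 1) * W.h i) :
    W.delivered i γ₀ (extend ω (i, d)) (k + 1) = (W.delivered i γ₀ ω (k + 1) || d) := by
  rw [Bool.eq_iff_iff, Bool.or_eq_true, W.delivered_succ_iff i i, W.delivered_succ_iff i i]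
  constructor
  · rintro ⟨s, h1, h2, h3⟩
    rcases lt_trichotomy s t with hs | rfl | hs
    · rw [toSeq_extend_of_lt _ _ _ hs] at h3
      exact Or.inl ⟨s, h1, h2, h3⟩
    · rw [toSeq_extend_self] at h3
      exact Or.inr (Prod.ext_iff.1 h3).2
    · simp [toSeq, show ¬ s < t + 1 by omega] at h3
  · rintro (⟨s, h1, h2, h3⟩ | rfl)
    · refine ⟨s, h1, h2, ?_⟩
      have hs : s < t := by
        by_contra hs
        simp [toSeq, hs] at h3
      rwa [toSeq_extend_of_lt _ _ _ hs]
    · exact ⟨t, hk, hk', toSeq_extend_self _ _ _⟩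

lemma packetState_eq_not_delivered (i : Fin N) (γ₀ : Bool) {t : ℕ} (ω : History N t) {k : ℕ}
    (hk : k * W.h i ≤ t) (hk' : t < (k + 1) * W.h i) :
    W.packetState ω i = !W.delivered i γ₀ ω (k + 1) := by
  have ht : t / W.h i = k := Nat.div_eq_of_lt_le hk hk'
  rw [Bool.eq_iff_iff, Bool.not_eq_true', ← Bool.not_eq_true, W.delivered_succ_iff i i]
  simp only [packetState, decide_eq_true_eq, ht]
  constructor
  · rintro h ⟨s, h1, h2, h3⟩
    have hs : s < t := by
      by_contra hs
      simp [toSeq, hs] at h3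
    refine h ⟨s, hs⟩ (Nat.div_eq_of_lt_le h1 h2) ?_
    simpa [toSeq, hs] using h3
  · intro h s h1 h2
    refine h ⟨s, ?_, ?_, ?_⟩
    · rw [← h1]
      exact Nat.div_mul_le_self _ _
    · have := s.2
      omega
    · simpa [toSeq] using h2

/-- The expectation of `g (γ_{k+1}) (x_{k+2}, u_{k+1})` given the history `ω`, which ends during
period `k + 1`. -/
def periodPotential (i : Fin N) (c : ControlPolicy) (x₁ u₀ : ℝ) (γ₀ : Bool)
    (g : Bool → ℝ × ℝ → ℝ) (k : ℕ) {t : ℕ} (ω : History N t) : ℝ :=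
  let P := W.closedLoop i c x₁ u₀ (W.delivered i γ₀ ω) (k + 1)
  if W.delivered i γ₀ ω (k + 1) = true then g true P
  else (1 - (1 - W.p i) ^ ((k + 1) * W.h i - t)) * g true P +
    (1 - W.p i) ^ ((k + 1) * W.h i - t) * g false P

/-- A martingale argument: while the packet is pending, it is lost with probability `1 - p` to the
number of remaining slots, and one more slot splits this consistently. The loop state at `k + 1` is
already fixed when the period begins. -/
lemma expect_periodPotential (i : Fin N) (c : ControlPolicy) (x₁ u₀ : ℝ) (γ₀ : Bool)
    (g : Bool → ℝ × ℝ → ℝ) (k : ℕ) {t : ℕ} (hk : k * W.h i ≤ t) (hk' : t ≤ (k + 1) * W.h i) :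
    W.expect (detPolicy fun _ _ => i) t (W.periodPotential i c x₁ u₀ γ₀ g k) =
      W.expect (detPolicy fun _ _ => i) (k * W.h i) (W.periodPotential i c x₁ u₀ γ₀ g k) := by
  induction t, hk using Nat.le_induction with
  | base => rfl
  | succ t hk ih =>
    rw [← ih (by omega), expect_succ]
    refine W.expect_congr _ _ fun ω => ?_
    have hP : ∀ d, W.closedLoop i c x₁ u₀ (W.delivered i γ₀ (extend ω (i, d))) (k + 1) =
        W.closedLoop i c x₁ u₀ (W.delivered i γ₀ ω) (k + 1) := fun d =>
      W.closedLoop_congr i c x₁ u₀ fun m hm => W.delivered_extend_of_le i γ₀ ω _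
        ((Nat.mul_le_mul_right _ (by omega)).trans hk)
    have hexp : (k + 1) * W.h i - t = (k + 1) * W.h i - (t + 1) + 1 := by omega
    simp only [periodPotential, hP, W.delivered_extend i γ₀ ω _ hk hk', successProb,
      W.packetState_eq_not_delivered i γ₀ ω hk hk']
    rw [hexp, pow_succ]
    generalize (k + 1) * W.h i - (t + 1) = n
    cases W.delivered i γ₀ ω (k + 1)
    · simp only [Bool.not_false, Bool.or_true, Bool.or_false, if_true, Bool.false_eq_true, if_false]
      ring
    · simp

/-- Dropouts under permanent service behave as independent events of probability `(1 - p) ^ h`: the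
potential is compared at the two ends of a period. -/
lemma expect_period (i : Fin N) (c : ControlPolicy) (x₁ u₀ : ℝ) (γ₀ : Bool)
    (g : Bool → ℝ × ℝ → ℝ) (k : ℕ) :
    W.expect (detPolicy fun _ _ => i) ((k + 1) * W.h i) (fun ω =>
        g (W.delivered i γ₀ ω (k + 1)) (W.closedLoop i c x₁ u₀ (W.delivered i γ₀ ω) (k + 1))) =
      W.expect (detPolicy fun _ _ => i) (k * W.h i) (fun ω =>
        (1 - (1 - W.p i) ^ W.h i) * g true (W.closedLoop i c x₁ u₀ (W.delivered i γ₀ ω) (k + 1)) +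
        (1 - W.p i) ^ W.h i * g false (W.closedLoop i c x₁ u₀ (W.delivered i γ₀ ω) (k + 1))) := by
  have hle : k * W.h i ≤ (k + 1) * W.h i := Nat.mul_le_mul_right _ (Nat.le_succ k)
  have h := W.expect_periodPotential i c x₁ u₀ γ₀ g k hle le_rfl
  refine Eq.trans (W.expect_congr _ _ fun ω => ?_) (h.trans (W.expect_congr _ _ fun ω => ?_))
  · rw [periodPotential, Nat.sub_self, pow_zero]
    cases W.delivered i γ₀ ω (k + 1) <;> simp
  · have hd : ¬ W.delivered i γ₀ ω (k + 1) = true := by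
      rw [W.delivered_succ_iff i i]
      rintro ⟨s, h1, -, h3⟩
      simp [toSeq, show ¬ s < k * W.h i by omega] at h3
    rw [periodPotential, if_neg hd, Nat.succ_mul, Nat.add_sub_cancel_left]

/-- A gain and a Lyapunov function for independent dropouts with a rate below the maximum. -/
lemma exists_lyapunov {a q : ℝ} (ha : 1 ≤ a) (hq : 0 ≤ q) (hq1 : q ≤ 1)
    (h : q * (a ^ 4 - a ^ 2 + 1) < 1) :
    ∃ L β ρ : ℝ, 0 < β ∧ 0 ≤ ρ ∧ ρ < 1 ∧ (a - (1 - q) * L) ^ 2 + β * L ^ 2 ≤ ρ ∧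
      a ^ 2 * q * (1 - q) ≤ ρ * β := by
  have ha0 : 0 < a := by linarith
  have hD : 0 < 1 - q + a ^ 2 * q := by
    have := mul_le_mul_of_nonneg_right (one_le_pow₀ ha (n := 2)) hq
    linarith
  set D := 1 - q + a ^ 2 * q with hD'
  -- `m` is the minimum over `L` of the first quadratic form at the limiting weight `β = a ^ 2 * q *
  -- (1 - q)`, attained at `L = a / D`. The hypothesis on `q` says exactly `m < 1`.
  set m := a ^ 4 * q / D with hm
  have hm0 : 0 ≤ m := by positivity
  have hm1 : m < 1 := by
    rw [hm, div_lt_one hD]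
    nlinarith
  set L := a / D with hL
  have hL0 : 0 < L := by positivity
  have hLm : (a - (1 - q) * L) ^ 2 + a ^ 2 * q * (1 - q) * L ^ 2 = m := by
    have h1 : a - (1 - q) * L = a * (a ^ 2 * q) / D := by
      rw [hL]
      field_simp
      rw [hD']
      ring
    rw [h1, hL, hm]
    field_simp
    rw [hD']
    ring
  set b₀ := a ^ 2 * q * (1 - q) with hb₀
  have hb0 : 0 ≤ b₀ := mul_nonneg (by positivity) (by linarith)
  -- Raising the weight by `ε` uses half of the slack `1 - m` and makes the second contraction
  -- strict.
  set ε := (1 - m) / (2 * L ^ 2) with hε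
  have hε0 : 0 < ε := div_pos (by linarith) (by positivity)
  have hβ : 0 < b₀ + ε := by linarith
  have hεL : ε * L ^ 2 = (1 - m) / 2 := by
    rw [hε]
    field_simp
  refine ⟨L, b₀ + ε, max ((1 + m) / 2) (b₀ / (b₀ + ε)), hβ, le_max_of_le_left (by linarith),
    max_lt (by linarith) ((div_lt_one hβ).2 (by linarith)), le_max_of_le_left ?_, ?_⟩
  · linarith
  · rw [← div_le_iff₀ hβ]
    exact le_max_right _ _

/-- Permanent service stabilizes a sub-system with a suitable control policy. -/
lemma exists_meanSquareStable_of_pow_lt_qMax (i : Fin N) (h : (1 - W.p i) ^ W.h i < W.qMax i) :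
    ∃ c, W.MeanSquareStable (detPolicy fun _ _ => i) c i := by
  set a := W.Abar i with ha
  set b := W.Bbar i with hb
  set q := (1 - W.p i) ^ W.h i with hq
  have hb0 : b ≠ 0 := W.Bbar_ne_zero i
  have ha1 : 1 ≤ a := Real.one_le_exp
    (mul_nonneg (mul_nonneg (W.A_nonneg i) (Nat.cast_nonneg _)) W.Δ_pos.le)
  have hq0 : 0 ≤ q := pow_nonneg (by linarith [W.p_le_one i]) _
  have hq1 : q ≤ 1 := pow_le_one₀ (by linarith [W.p_le_one i]) (by linarith [W.p_pos i])
  have hqM : q * (a ^ 4 - a ^ 2 + 1) < 1 := by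
    have h4 : Real.exp (4 * W.A i * W.h i * W.Δ) = a ^ 4 := by
      rw [ha, Abar, ← Real.exp_nat_mul]
      congr 1
      push_cast
      ring
    have h2 : Real.exp (2 * W.A i * W.h i * W.Δ) = a ^ 2 := by
      rw [ha, Abar, ← Real.exp_nat_mul]
      congr 1
      push_cast
      ring
    rw [qMax, h4, h2] at h
    rwa [← lt_div_iff₀ (by nlinarith [sq_nonneg (a ^ 2 - 1)])]
  obtain ⟨L, β, ρ, hβ, hρ0, hρ1, hL1, hL2⟩ := exists_lyapunov ha1 hq0 hq1 hqM
  set c : ControlPolicy := ⟨L / b, q, hq0, hq1⟩ with hc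
  refine ⟨c, fun x₁ u₀ γ₀ => ?_⟩
  set π : SchedulingPolicy N := detPolicy fun _ _ => i with hπ
  -- The first square is the predicted state `z`. Since `a * x + γ * w` has mean `z` and variance `q
  -- * (1 - q) * w ^ 2`, the mean of `V` after a step has no cross term in `z` and `w`.
  set V : ℝ × ℝ → ℝ := fun P => (a * P.1 + (1 - q) * (b * P.2)) ^ 2 + β * (b * P.2) ^ 2 with hV
  have hV0 : ∀ P, 0 ≤ V P := fun P => by positivity
  have hstep : ∀ P, (1 - q) * V (W.loopStep i c P true) + q * V (W.loopStep i c P false) ≤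
      ρ * V P := by
    intro P
    set w := b * P.2 with hw
    set z := a * P.1 + (1 - q) * w with hz
    have hs : ∀ g, V (W.loopStep i c P g) =
        (a * (a * P.1 + (if g = true then 1 else 0) * w) - (1 - q) * (L * z)) ^ 2 +
          β * (L * z) ^ 2 := by
      intro g
      have h1 : b * (W.loopStep i c P g).2 = -(L * z) := by
        change b * (-(L / b) * (a * P.1 + (1 - q) * b * P.2)) = _
        rw [hz, hw]
        field_simp
      have h2 : (W.loopStep i c P g).1 = a * P.1 + (if g = true then 1 else 0) * w := by
        change a * P.1 + (if g = true then 1 else 0) * b * P.2 = _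
        rw [hw]
        ring
      simp only [hV, h1, h2]
      ring
    have hVP : V P = z ^ 2 + β * w ^ 2 := rfl
    rw [hs, hs, hVP]
    simp only [if_true, Bool.false_eq_true, if_false]
    have e1 := mul_le_mul_of_nonneg_right hL1 (sq_nonneg z)
    have e2 := mul_le_mul_of_nonneg_right hL2 (sq_nonneg w)
    have e3 : (1 - q) * ((a * (a * P.1 + 1 * w) - (1 - q) * (L * z)) ^ 2 + β * (L * z) ^ 2) +
        q * ((a * (a * P.1 + 0 * w) - (1 - q) * (L * z)) ^ 2 + β * (L * z) ^ 2) =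
        ((a - (1 - q) * L) ^ 2 + β * L ^ 2) * z ^ 2 + a ^ 2 * q * (1 - q) * w ^ 2 := by
      rw [hz]
      ring
    rw [e3]
    linarith
  have hx : ∀ P : ℝ × ℝ, |P.1| ^ 2 ≤ (2 + 2 / β) * V P := by
    intro P
    set w := b * P.2 with hw
    set z := a * P.1 + (1 - q) * w with hz
    have hVP : V P = z ^ 2 + β * w ^ 2 := rfl
    have h1 : P.1 ^ 2 ≤ (a * P.1) ^ 2 := by
      rw [mul_pow]
      exact le_mul_of_one_le_left (sq_nonneg _) (one_le_pow₀ ha1)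
    have h2 : a * P.1 = z - (1 - q) * w := by rw [hz]; ring
    have h3 : ((1 - q) * w) ^ 2 ≤ w ^ 2 := by
      rw [mul_pow]
      exact mul_le_of_le_one_left (sq_nonneg _) (pow_le_one₀ (by linarith) (by linarith))
    have h4 : (2 + 2 / β) * V P = 2 * z ^ 2 + 2 * w ^ 2 + (2 * β * w ^ 2 + 2 / β * z ^ 2) := by
      rw [hVP]
      field_simp
      ring
    have h5 : 0 ≤ 2 * β * w ^ 2 + 2 / β * z ^ 2 := by positivity
    rw [sq_abs, h4]
    rw [h2] at h1
    nlinarith [sq_nonneg (z + (1 - q) * w)]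
  set A : ℕ → ℝ := fun k => W.expect π (k * W.h i) fun ω =>
    V (W.closedLoop i c x₁ u₀ (W.delivered i γ₀ ω) (k + 1)) with hA
  have hdecay : ∀ k, A k ≤ ρ ^ k * A 0 := by
    intro k
    induction k with
    | zero => simp
    | succ k ih =>
      have h1 : A (k + 1) = _ :=
        W.expect_period i c x₁ u₀ γ₀ (fun g P => V (W.loopStep i c P g)) k
      have h2 : A (k + 1) ≤ ρ * A k := by
        rw [h1, hA, ← expect_const_mul]
        exact W.expect_mono _ _ fun ω => hstep _
      calc A (k + 1) ≤ ρ * A k := h2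
        _ ≤ ρ * (ρ ^ k * A 0) := mul_le_mul_of_nonneg_left ih hρ0
        _ = _ := by ring
  have hmom : ∀ k, W.secondMoment π c i x₁ u₀ γ₀ (k + 1) ≤ (2 + 2 / β) * (ρ ^ k * A 0) := by
    intro k
    -- The same loop state, seen one period later: its expectation is unchanged because it does not
    -- involve `γ (k + 1)`.
    have h1 : W.expect π ((k + 1) * W.h i)
        (fun ω => V (W.closedLoop i c x₁ u₀ (W.delivered i γ₀ ω) (k + 1))) = A k := by
      refine (W.expect_period i c x₁ u₀ γ₀ (fun _ P => V P) k).trans ?_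
      refine W.expect_congr _ _ fun ω => ?_
      ring
    calc W.secondMoment π c i x₁ u₀ γ₀ (k + 1)
        = W.expect π ((k + 1) * W.h i) fun ω =>
            |(W.closedLoop i c x₁ u₀ (W.delivered i γ₀ ω) (k + 1)).1| ^ 2 := rfl
      _ ≤ W.expect π ((k + 1) * W.h i) fun ω =>
            (2 + 2 / β) * V (W.closedLoop i c x₁ u₀ (W.delivered i γ₀ ω) (k + 1)) :=
          W.expect_mono _ _ fun ω => hx _
      _ = (2 + 2 / β) * A k := by rw [expect_const_mul, h1]
      _ ≤ _ := mul_le_mul_of_nonneg_left (hdecay k) (by positivity)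
  rw [← tendsto_add_atTop_iff_nat 1]
  refine squeeze_zero (fun k => ?_) hmom ?_
  · exact W.expect_nonneg π _ fun ω => by positivity
  · simpa using ((tendsto_pow_atTop_nhds_zero_of_lt_one hρ0 hρ1).mul_const (A 0)).const_mul
      (2 + 2 / β)

end WNCS

end

theorem theorem6 {N : ℕ} (W : WNCS N) (x : ℕ → (Fin N → Bool) → Fin N → ℝ)
    (hflow : ∀ s' : Fin N → Bool, ∀ t ∈ Finset.Icc 1 (W.H - 1),
      ∑ a, x (t + 1) s' a = ∑ s, ∑ a, x t s a * W.transProb t s a s')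
    (hcycle : ∀ s' : Fin N → Bool,
      ∑ a, x 1 s' a = ∑ s, ∑ a, x W.H s a * W.transProb W.H s a s')
    (hrate : ∀ i : Fin N, ∀ j ∈ Finset.Icc 1 (W.n i),
      1 - W.qMax i <
        ∑ t ∈ Finset.Icc ((j - 1) * W.h i + 1) (j * W.h i), ∑ s, ∑ a, x t s a * W.reward i s a)
    (hprob : ∀ t ∈ Finset.Icc 1 W.H, ∑ s, ∑ a, x t s a = 1)
    (hnonneg : ∀ t ∈ Finset.Icc 1 W.H, ∀ s a, 0 ≤ x t s a) :
    W.CanBeStabilized := by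
  have hrate' := WNCS.one_sub_p_pow_lt_qMax hflow hrate hprob hnonneg
  rcases lt_trichotomy N 1 with hN | rfl | hN
  · obtain rfl : N = 0 := by omega
    -- Without sub-systems there is no action, so the total mass would be an empty sum.
    have := hprob 1 (Finset.mem_Icc.2 ⟨le_rfl, W.H_pos⟩)
    simp at this
  · obtain ⟨c, hc⟩ := W.exists_meanSquareStable_of_pow_lt_qMax 0 (hrate' 0)
    refine ⟨WNCS.detPolicy fun _ _ => 0, fun _ => c, fun i => ?_⟩
    rwa [Subsingleton.elim i 0]
  · have : Nontrivial (Fin N) := Fin.nontrivial_iff_two_le.2 hN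
    exact W.canBeStabilized_of_nontrivial fun i => W.one_sub_p_lt i (hrate' i)
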